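/- Let $\mathbb{N}=\{0,1,2,\dots\}$. For $n\in\mathbb{N}$ let $b(n)$ be the number of partitions of $n$ into powers of two, and let $$b_3(n)=\sum_{i_1+i_2+i_3=n} b(i_1)\,b(i_2)\,b(i_3),$$ the sum being over $i_1,i_2,i_3\in\mathbb{N}$. Let $S_3$ be the set of all $n\in\mathbb{N}$ such that $b_3(n)\neq u^2+v^2+w^2$ for all $u,v,w\in\mathbb{Z}$, and for real $x\ge 0$ put $S_3(x)=\#\{n\in S_3: n\le x\}$. Then: 1. For every real $x\ge 1$, $$-\frac16\log_2 x-\frac7{12}<S_3(x)-\frac{x}{12}.$$ 2. For every real $x\ge 1$ with $x+2\log_2 x\ge 2$ (that is, for every $x\geq x_0$, where $x_0=1.28\ldots$ is the root of $x+2\log_2 x=2$; in particular for every $x\ge 2$), $$S_3(x)-\frac{x}{12}\le\frac16\log_2 x-\frac16 .$$ 3. The set $S_3$ has natural density $\frac1{12}$: $$\lim_{x\to+\infty}\frac{S_3(x)}{x}=\frac1{12}.$$ 4. Let $(m_l)_{l\in\mathbb{N}}$ and $(n_l)_{l\in\mathbb{N}}$ be the strictly increasing sequences given by $m_0=n_0=0$,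 $m_{l+1}=4m_l+8$, $n_{l+1}=4n_l+16$. Then, as $l\to\infty$, $$S_3(m_l)-\frac{m_l}{12}\sim\frac16\log_2 m_l,\qquad S_3(n_l)-\frac{n_l}{12}\sim-\frac16\log_2 n_l .$$ -/

import Mathlib

open Filter Topology

/-- The binary partition function `b(n)`: the number of partitions of `n` into powers of two. -/
noncomputable def binaryPartition (n : ℕ) : ℕ :=
  Nat.card {p : Nat.Partition n // ∀ i ∈ p.parts, ∃ k : ℕ, i = 2 ^ k}

/-- `b_m(n)`, the convolution of `m` copies of `b`:
the sum of `b(i_1) ⋯ b(i_m)` over all `(i_1, …, i_m)` with `i_1 + ⋯ + i_m = n`. -/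
noncomputable def coloredBinaryPartition (m n : ℕ) : ℕ :=
  ∑ f ∈ Finset.finAntidiagonal m n, ∏ j : Fin m, binaryPartition (f j)

/-- `S_m`, the set of those `n` for which `b_m(n)` is not a sum of three integer squares. -/
def exceptionalSet (m : ℕ) : Set ℕ :=
  {n | ¬ ∃ x y z : ℤ, (coloredBinaryPartition m n : ℤ) = x ^ 2 + y ^ 2 + z ^ 2}

/-- The counting function `S_m(x)`, the number of elements of `S_m` that are at most `x`. -/
noncomputable def exceptionalCount (m : ℕ) (x : ℝ) : ℕ :=
  Set.ncard {n : ℕ | n ∈ exceptionalSet m ∧ (n : ℝ) ≤ x}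

/-! Let `t` be the Thue–Morse sequence (`digitParity`). Since the cube `F` of the generating
function of `b` satisfies `(1 - X)^3 F(X) = F(X^2)`, the residue of `b_3` modulo 32 has a closed
form in `t` and the odd part of `n` modulo 4 (`coloredBinaryPartition_three_residue`). Cut the
integers into blocks `4(j+1), ..., 4(j+1)+3`. If `t(j+1) ≠ t(j)`, all four values are 2 mod 4, hence
sums of three squares. If `t(j+1) = t(j)`, one value is 28 mod 32, not a sum of three squares, and
the others are 4 times 1, 3 or 5 mod 8, which are sums (`residueSeq_four_mul_add`). So counting
`S_3` amounts to counting repetitions in `t` (`exceptionalBelow_four_mul`). With `A = repeatCount`,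
the self-similarity of `t` gives `A(4M+r) = A(M) + M`, plus 1 when `r ≥ 2`. Hence `3A(N) - N` is the
number of digits 2 minus the number of digits 1 of `N` in base 4. This is logarithmically bounded,
whence the bounds and the density 1/3 · 1/4; numbers with digits all 2 or essentially all 1 are
extremal. -/

/-! ### Sums of three squares -/

/-- Davenport–Cassels descent. -/
lemma sum_three_squares_of_mul_sq (n : ℤ) : ∀ (t : ℕ), 0 < t → ∀ x y z : ℤ,
    x ^ 2 + y ^ 2 + z ^ 2 = n * (t : ℤ) ^ 2 → ∃ a b c : ℤ, n = a ^ 2 + b ^ 2 + c ^ 2 := by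
  intro t
  induction t using Nat.strong_induction_on with
  | _ t ih =>
  intro ht x y z h
  have ht' : (0 : ℤ) < t := by exact_mod_cast ht
  have near : ∀ x : ℤ, ∃ a : ℤ, (2 * (t * a - x)) ^ 2 ≤ (t : ℤ) ^ 2 := by
    intro x
    -- The integer nearest to `x / t`.
    refine ⟨(2 * x + t) / (2 * t), ?_⟩
    have h1 := Int.emod_add_mul_ediv (2 * x + t) (2 * t)
    have h2 := Int.emod_nonneg (2 * x + t) (b := 2 * (t : ℤ)) (by positivity)
    have h3 := Int.emod_lt_of_pos (2 * x + t) (b := 2 * (t : ℤ)) (by positivity)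
    apply sq_le_sq'
    · linarith
    · linarith
  obtain ⟨a, ha⟩ := near x
  obtain ⟨b, hb⟩ := near y
  obtain ⟨c, hc⟩ := near z
  -- The line through `(x, y, z) / t` and the nearby lattice point `(a, b, c)` meets the sphere
  -- again at a point of denominator `t'`; `t' < t` because the squared distance is at most 3/4.
  set t' : ℤ := t * (a ^ 2 + b ^ 2 + c ^ 2) - 2 * (x * a + y * b + z * c) + n * t with ht'_def
  have key : (t : ℤ) * t' = (t * a - x) ^ 2 + (t * b - y) ^ 2 + (t * c - z) ^ 2 := by
    rw [ht'_def]; linear_combination (-1) * h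
  have h0 : 0 ≤ t' := by
    by_contra hneg
    push Not at hneg
    nlinarith [sq_nonneg ((t : ℤ) * a - x), sq_nonneg ((t : ℤ) * b - y),
      sq_nonneg ((t : ℤ) * c - z), mul_neg_of_pos_of_neg ht' hneg]
  have hlt : t' < t := by
    by_contra hge
    push Not at hge
    nlinarith [mul_le_mul_of_nonneg_left hge ht'.le]
  rcases h0.eq_or_lt with h0 | hpos
  · refine ⟨a, b, c, ?_⟩
    rw [← h0, mul_zero] at key
    have e1 : (t * a - x) ^ 2 = 0 := by
      nlinarith [sq_nonneg ((t : ℤ) * a - x), sq_nonneg ((t : ℤ) * b - y),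
        sq_nonneg ((t : ℤ) * c - z)]
    have e2 : (t * b - y) ^ 2 = 0 := by
      nlinarith [sq_nonneg ((t : ℤ) * a - x), sq_nonneg ((t : ℤ) * b - y),
        sq_nonneg ((t : ℤ) * c - z)]
    have e3 : (t * c - z) ^ 2 = 0 := by
      nlinarith [sq_nonneg ((t : ℤ) * a - x), sq_nonneg ((t : ℤ) * b - y),
        sq_nonneg ((t : ℤ) * c - z)]
    have e1 := sub_eq_zero.1 (pow_eq_zero_iff (two_ne_zero)|>.1 e1)
    have e2 := sub_eq_zero.1 (pow_eq_zero_iff (two_ne_zero)|>.1 e2)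
    have e3 := sub_eq_zero.1 (pow_eq_zero_iff (two_ne_zero)|>.1 e3)
    have : (t : ℤ) ^ 2 * n = t ^ 2 * (a ^ 2 + b ^ 2 + c ^ 2) := by
      rw [← e1, ← e2, ← e3] at h; linear_combination (-1) * h
    exact mul_left_cancel₀ (by positivity) this
  · lift t' to ℕ using hpos.le with s hs
    refine ih s (by exact_mod_cast hlt) (by exact_mod_cast hpos)
      ((a ^ 2 + b ^ 2 + c ^ 2 - n) * x + 2 * (n * t - (x * a + y * b + z * c)) * a)
      ((a ^ 2 + b ^ 2 + c ^ 2 - n) * y + 2 * (n * t - (x * a + y * b + z * c)) * b)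
      ((a ^ 2 + b ^ 2 + c ^ 2 - n) * z + 2 * (n * t - (x * a + y * b + z * c)) * c) ?_
    rw [hs]
    linear_combination (a ^ 2 + b ^ 2 + c ^ 2 - n) ^ 2 * h

lemma sq_sub_le_of_lt_sqrt {N a b : ℕ} (ha : a < N.sqrt + 1) (hb : b < N.sqrt + 1) :
    ((a : ℤ) - b) ^ 2 ≤ N := by
  have h : ((N.sqrt : ℕ) : ℤ) ^ 2 ≤ N := by exact_mod_cast Nat.sqrt_le' N
  refine le_trans (sq_le_sq' ?_ ?_) h <;> omega

/-- Pigeonhole in the manner of Thue: the box has more than `n * P` points, so two of them agree in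
both congruences, and their difference is taken. -/
lemma exists_small_solution (n P : ℕ) (hn : 0 < n) (hP : 0 < P) (s : ℤ) :
    ∃ z u w : ℤ, (z, u, w) ≠ 0 ∧ (P : ℤ) ∣ z - s * w ∧ (n : ℤ) ∣ z - u ∧
      z ^ 2 ≤ n * P ∧ u ^ 2 ≤ n ∧ w ^ 2 ≤ P := by
  have : NeZero n := ⟨hn.ne'⟩
  have : NeZero P := ⟨hP.ne'⟩
  let S : Finset (ℕ × ℕ × ℕ) := Finset.range ((n * P).sqrt + 1) ×ˢ
    Finset.range (n.sqrt + 1) ×ˢ Finset.range (P.sqrt + 1)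
  let f : ℕ × ℕ × ℕ → ZMod P × ZMod n := fun v => ((v.1 : ZMod P) - s * v.2.2, (v.1 : ZMod n) - v.2.1)
  have hcard : (Finset.univ : Finset (ZMod P × ZMod n)).card < S.card := by
    simp only [S, Finset.card_univ, Fintype.card_prod, ZMod.card, Finset.card_product,
      Finset.card_range]
    have h1 := Nat.lt_succ_sqrt' (n * P)
    have h2 := Nat.lt_succ_sqrt' n
    have h3 := Nat.lt_succ_sqrt' P
    simp only [Nat.succ_eq_add_one] at h1 h2 h3
    refine lt_of_pow_lt_pow_left₀ 2 (Nat.zero_le _) ?_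
    calc (P * n) ^ 2 = (n * P) * (n * P) := by ring
      _ < ((n * P).sqrt + 1) ^ 2 * ((n.sqrt + 1) ^ 2 * (P.sqrt + 1) ^ 2) := by gcongr
      _ = _ := by ring
  obtain ⟨v, hv, v', hv', hne, hf⟩ := Finset.exists_ne_map_eq_of_card_lt_of_maps_to hcard
    (f := f) (fun _ _ => by simp)
  obtain ⟨z, u, w⟩ := v
  obtain ⟨z', u', w'⟩ := v'
  simp only [S, Finset.mem_product, Finset.mem_range] at hv hv'
  simp only [f, Prod.mk.injEq] at hf
  refine ⟨z - z', u - u', w - w', ?_, ?_, ?_, ?_, sq_sub_le_of_lt_sqrt hv.2.1 hv'.2.1,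
    sq_sub_le_of_lt_sqrt hv.2.2 hv'.2.2⟩
  · intro h
    simp only [Prod.mk_eq_zero] at h
    apply hne
    simp only [Prod.mk.injEq]
    omega
  · rw [← ZMod.intCast_zmod_eq_zero_iff_dvd]
    push_cast
    linear_combination hf.1
  · rw [← ZMod.intCast_zmod_eq_zero_iff_dvd]
    push_cast
    linear_combination hf.2
  · have := sq_sub_le_of_lt_sqrt hv.1 hv'.1
    push_cast at this
    exact this

/-- A special case of Legendre's theorem on ternary quadratic forms. -/
lemma exists_mul_sq_eq_sq_add_mul_sq (n P : ℕ) (hn : 0 < n) (hP : ¬ IsSquare P)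
    (hnP : ¬ IsSquare (n * P)) (hcop : n.Coprime P) (s : ℤ) (hs : (P : ℤ) ∣ s ^ 2 - n)
    (hr : n ∣ P + 1) :
    ∃ X Y W : ℤ, W ≠ 0 ∧ n * W ^ 2 = X ^ 2 + P * Y ^ 2 := by
  have hP0 : 0 < P := Nat.pos_of_ne_zero fun h => hP (h ▸ ⟨0, rfl⟩)
  have hn' : (0 : ℤ) < n := by exact_mod_cast hn
  have hP' : (0 : ℤ) < P := by exact_mod_cast hP0
  obtain ⟨z, u, w, hne, h1, h2, hz, hu, hw⟩ := exists_small_solution n P hn hP0 s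
  have d1 : (P : ℤ) ∣ z ^ 2 + P * u ^ 2 - n * w ^ 2 := by
    obtain ⟨a, ha⟩ := h1
    obtain ⟨b, hb⟩ := hs
    obtain rfl : z = s * w + P * a := by linear_combination ha
    exact ⟨2 * s * w * a + P * a ^ 2 + u ^ 2 + b * w ^ 2, by linear_combination w ^ 2 * hb⟩
  have d2 : (n : ℤ) ∣ z ^ 2 + P * u ^ 2 - n * w ^ 2 := by
    obtain ⟨a, ha⟩ := h2
    obtain ⟨b, hb⟩ := hr
    have hb : (P : ℤ) + 1 = n * b := by exact_mod_cast hb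
    obtain rfl : z = u + n * a := by linear_combination ha
    exact ⟨2 * u * a + n * a ^ 2 + b * u ^ 2 - w ^ 2, by linear_combination u ^ 2 * hb⟩
  obtain ⟨k, hk⟩ := (Nat.isCoprime_iff_coprime.2 hcop).mul_dvd d2 d1
  have hz' : z ^ 2 ≠ n * P := fun h => hnP ⟨z.natAbs, by zify; rw [← sq, sq_abs, h]⟩
  have hw' : w ^ 2 ≠ P := fun h => hP ⟨w.natAbs, by zify; rw [← sq, sq_abs, h]⟩
  have hz := lt_of_le_of_ne hz hz'
  have hw := lt_of_le_of_ne hw hw'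
  have hnP' : (0 : ℤ) < n * P := by positivity
  -- The size bounds, strict for `z` and `w` by the non-square hypotheses, place the form strictly
  -- between `-nP` and `2nP`.
  have hk2 : k < 2 := by
    by_contra! hge
    nlinarith [mul_le_mul_of_nonneg_left hge hnP'.le, mul_le_mul_of_nonneg_left hu hP'.le,
      sq_nonneg w, mul_nonneg hn'.le (sq_nonneg w)]
  have hk0 : -1 < k := by
    by_contra! hge
    nlinarith [mul_le_mul_of_nonneg_left hge hnP'.le, mul_lt_mul_of_pos_left hw hn',
      sq_nonneg z, mul_nonneg hP'.le (sq_nonneg u)]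
  obtain rfl | rfl : k = 0 ∨ k = 1 := by omega
  · refine ⟨z, u, w, ?_, by linear_combination (-1) * hk⟩
    rintro rfl
    apply hne
    have hz0 : z ^ 2 = 0 := by
      nlinarith [sq_nonneg z, mul_nonneg hP'.le (sq_nonneg u)]
    have hu0 : (P : ℤ) * u ^ 2 = 0 := by
      nlinarith [sq_nonneg z, mul_nonneg hP'.le (sq_nonneg u)]
    simp only [mul_eq_zero, hP'.ne', false_or] at hu0
    simp [pow_eq_zero_iff two_ne_zero |>.1 hz0, pow_eq_zero_iff two_ne_zero |>.1 hu0]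
  -- For `k = 1`, `n (w² + P) = z² + P u²`; multiply by `w² + P` and use Brahmagupta's identity.
  · refine ⟨z * w + P * u, u * w - z, w ^ 2 + P, by positivity, ?_⟩
    linear_combination (-1) * (w ^ 2 + P) * hk

/-- When `P` is a sum of two squares, so is `P Y²`; thus `n W²` is a sum of three squares and the
descent removes `W²`. -/
lemma sum_three_squares_aux (n P : ℕ) (hn : 0 < n) (hP : ¬ IsSquare P)
    (hnP : ¬ IsSquare (n * P)) (hcop : n.Coprime P) (s : ℤ) (hs : (P : ℤ) ∣ s ^ 2 - n)
    (hr : n ∣ P + 1) (hP2 : ∃ a b : ℕ, P = a ^ 2 + b ^ 2) :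
    ∃ a b c : ℤ, (n : ℤ) = a ^ 2 + b ^ 2 + c ^ 2 := by
  obtain ⟨X, Y, W, hW, h⟩ := exists_mul_sq_eq_sq_add_mul_sq n P hn hP hnP hcop s hs hr
  obtain ⟨a, b, rfl⟩ := hP2
  refine sum_three_squares_of_mul_sq n W.natAbs (Int.natAbs_pos.2 hW) X (a * Y) (b * Y) ?_
  rw [Int.natCast_natAbs, sq_abs, h]
  push_cast
  ring

lemma not_isSquare_of_prime_dvd {p m : ℕ} (hp : p.Prime) (hm : ¬ p ∣ m) : ¬ IsSquare (m * p) := by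
  rintro ⟨k, hk⟩
  have hpk : p ∣ k := by
    have : p ∣ k * k := hk ▸ dvd_mul_left p m
    exact (hp.dvd_mul.1 this).elim id id
  obtain ⟨c, rfl⟩ := hpk
  apply hm
  exact ⟨c * c, Nat.eq_of_mul_eq_mul_right hp.pos (by linear_combination hk)⟩

lemma exists_prime_sum_two_squares {n a : ℕ} (hn : 0 < n) (ha : a.Coprime (4 * n)) (ha4 : a % 4 = 1) :
    ∃ p : ℕ, p.Prime ∧ n < p ∧ p ≡ a [MOD 4 * n] ∧ p % 4 = 1 ∧ ∃ x y : ℕ, p = x ^ 2 + y ^ 2 := by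
  obtain ⟨p, hpn, hp, hpa⟩ := Nat.forall_exists_prime_gt_and_modEq n (by positivity) ha
  have h4 : p % 4 = 1 := by
    have := hpa.of_mul_right n
    rw [Nat.ModEq] at this
    omega
  have : Fact p.Prime := ⟨hp⟩
  obtain ⟨x, y, hxy⟩ := Nat.Prime.sq_add_sq (p := p) (by omega)
  exact ⟨p, hp, hpn, hpa, h4, x, y, hxy.symm⟩

lemma exists_sq_sub_of_jacobiSym {n p : ℕ} (hp : p.Prime) (h : jacobiSym n p = 1) :
    ∃ s : ℤ, (p : ℤ) ∣ s ^ 2 - n := by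
  have : Fact p.Prime := ⟨hp⟩
  obtain ⟨r, hr⟩ := ZMod.isSquare_of_jacobiSym_eq_one h
  refine ⟨r.valMinAbs, ?_⟩
  rw [← ZMod.intCast_zmod_eq_zero_iff_dvd]
  push_cast
  push_cast at hr
  rw [hr]
  ring

lemma sum_three_squares_of_prime {n p : ℕ} (hn : 0 < n) (hp : p.Prime) (hnp : n < p)
    (hxy : ∃ x y : ℕ, p = x ^ 2 + y ^ 2) (hr : n ∣ p + 1) (h : jacobiSym n p = 1) :
    ∃ a b c : ℤ, (n : ℤ) = a ^ 2 + b ^ 2 + c ^ 2 := by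
  obtain ⟨s, hs⟩ := exists_sq_sub_of_jacobiSym hp h
  have hd : ¬ p ∣ n := fun hd => absurd (Nat.le_of_dvd hn hd) (by omega)
  exact sum_three_squares_aux n p hn (fun h => hp.not_isSquare h)
    (not_isSquare_of_prime_dvd hp hd) ((Nat.Prime.coprime_iff_not_dvd hp).2 hd).symm s hs hr hxy

/-- Dirichlet's theorem gives a prime `p ≡ 2n - 1` mod `4n`, so `p ≡ -1` mod `n` and `p ≡ 1` mod 4;
by reciprocity `(n/p) = (p/n) = (-1/n) = 1`. -/
lemma sum_three_squares_of_mod_four_eq_one {n : ℕ} (h : n % 4 = 1) :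
    ∃ a b c : ℤ, (n : ℤ) = a ^ 2 + b ^ 2 + c ^ 2 := by
  have hn : 0 < n := by omega
  have hc : (2 * n - 1).Coprime (4 * n) := by
    refine Nat.Coprime.mul_right ?_ ?_
    · rw [show 4 = 2 ^ 2 by rfl]
      exact Nat.Coprime.pow_right _ (Nat.coprime_two_right.2 ⟨n - 1, by omega⟩)
    · refine Nat.Coprime.of_dvd_right (Dvd.intro_left 2 rfl) ?_
      exact (Nat.coprime_self_sub_left (by omega)).2 (Nat.coprime_one_left _)
  obtain ⟨p, hp, hnp, hpa, hp4, hxy⟩ := exists_prime_sum_two_squares hn hc (by omega)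
  have hpn : p + 1 ≡ 0 [MOD n] := by
    have := (hpa.of_mul_left 4).add_right 1
    rw [show 2 * n - 1 + 1 = n * 2 by omega] at this
    exact this.trans (by simp [Nat.ModEq])
  refine sum_three_squares_of_prime hn hp hnp hxy (Nat.modEq_zero_iff_dvd.1 hpn) ?_
  have hpo : Odd p := Nat.odd_iff.2 (by omega)
  have hno : Odd n := Nat.odd_iff.2 (by omega)
  rw [jacobiSym.quadratic_reciprocity_one_mod_four h hpo,
    jacobiSym.mod_left' (a₂ := -1), jacobiSym.at_neg_one hno, ZMod.χ₄_nat_one_mod_four h]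
  rw [← Int.ModEq, Int.modEq_iff_dvd]
  have := (Nat.modEq_zero_iff_dvd.1 hpn)
  have : (n : ℤ) ∣ p + 1 := by exact_mod_cast this
  obtain ⟨k, hk⟩ := this
  exact ⟨-k, by linear_combination -hk⟩

/-- Here `P = 2p` with `2p ≡ -1` mod `n`: `(n/p) = (p/n) = (-2/n) = 1` since `n ≡ 3` mod 8. -/
lemma sum_three_squares_of_mod_eight_eq_three {n : ℕ} (h : n % 8 = 3) :
    ∃ a b c : ℤ, (n : ℤ) = a ^ 2 + b ^ 2 + c ^ 2 := by
  have hn : 0 < n := by omega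
  obtain ⟨m, rfl⟩ : ∃ m, n = 2 * m + 1 := ⟨n / 2, by omega⟩
  have hc : m.Coprime (4 * (2 * m + 1)) := by
    refine Nat.Coprime.mul_right ?_ ?_
    · rw [show 4 = 2 ^ 2 by rfl]
      exact Nat.Coprime.pow_right _ (Nat.coprime_two_right.2 (Nat.odd_iff.2 (by omega)))
    · simp
  obtain ⟨p, hp, hnp, hpa, hp4, x, y, hxy⟩ := exists_prime_sum_two_squares hn hc (by omega)
  have hpn : (2 * m + 1) ∣ 2 * p + 1 := by
    have h1 := ((hpa.of_mul_left 4).mul_left 2).add_right 1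
    exact Nat.modEq_zero_iff_dvd.1 (h1.trans (by simp [Nat.ModEq]))
  have hpo : Odd p := Nat.odd_iff.2 (by omega)
  have hno : Odd (2 * m + 1) := by simp
  have hd : ¬ p ∣ 2 * m + 1 := fun hd => absurd (Nat.le_of_dvd hn hd) (by omega)
  have hj : jacobiSym ((2 * m + 1 : ℕ) : ℤ) p = 1 := by
    rw [jacobiSym.quadratic_reciprocity_one_mod_four' hno hp4]
    have e : jacobiSym (-2 * p) (2 * m + 1) = 1 := by
      rw [jacobiSym.mod_left' (a₂ := 1), jacobiSym.one_left]
      rw [← Int.ModEq, Int.modEq_iff_dvd]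
      have : (((2 * m + 1 : ℕ) : ℤ)) ∣ 2 * p + 1 := by exact_mod_cast hpn
      convert this using 1; ring
    have e2 : jacobiSym (-2) (2 * m + 1) = 1 := by
      rw [jacobiSym.at_neg_two hno, ZMod.χ₈'_nat_eq_if_mod_eight]
      simp [h]
    rwa [jacobiSym.mul_left, e2, one_mul] at e
  obtain ⟨s, hs⟩ := exists_sq_sub_of_jacobiSym hp hj
  -- An odd root makes `s'² - n` even, so divisibility extends from `p` to `2p`.
  obtain ⟨s', hs', hodd⟩ : ∃ s' : ℤ, (p : ℤ) ∣ s' ^ 2 - (2 * m + 1 : ℕ) ∧ Odd s' := by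
    rcases Int.even_or_odd s with he | ho
    · refine ⟨s + p, ?_, he.add_odd (by exact_mod_cast hpo)⟩
      obtain ⟨k, hk⟩ := hs
      exact ⟨k + 2 * s + p, by linear_combination hk⟩
    · exact ⟨s, hs, ho⟩
  have h2p : ((2 : ℕ)).Coprime p := by simpa using hpo
  have h2n : ((2 : ℕ)).Coprime (2 * m + 1) := by simp
  refine sum_three_squares_aux (2 * m + 1) (2 * p) hn ?_ ?_ ?_ s' ?_ hpn ⟨x + y, ((x : ℤ) - y).natAbs, ?_⟩
  · exact not_isSquare_of_prime_dvd hp (fun hd => by have := Nat.le_of_dvd two_pos hd; omega)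
  · rw [← mul_assoc]
    refine not_isSquare_of_prime_dvd hp fun hd' => ?_
    rcases hp.dvd_mul.1 hd' with h' | h'
    · exact hd h'
    · have := Nat.le_of_dvd two_pos h'; omega
  · exact Nat.Coprime.mul_right h2n.symm ((Nat.Prime.coprime_iff_not_dvd hp).2 hd).symm
  · push_cast
    refine IsCoprime.mul_dvd (by exact_mod_cast Nat.isCoprime_iff_coprime.2 h2p) ?_
      (by exact_mod_cast hs')
    obtain ⟨k, rfl⟩ := hodd
    exact ⟨2 * k ^ 2 + 2 * k - m, by ring⟩
  · zify
    rw [sq_abs]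
    have : (p : ℤ) = x ^ 2 + y ^ 2 := by exact_mod_cast hxy
    rw [this]; ring

/-- With `n = 2m` and `p ≡ 2m - 1` mod `8m`, the symbols `(2/p)` and `(p/m) = (-1/m)` are equal,
both determined by `m` mod 4. -/
lemma sum_three_squares_of_mod_four_eq_two {n : ℕ} (h : n % 4 = 2) :
    ∃ a b c : ℤ, (n : ℤ) = a ^ 2 + b ^ 2 + c ^ 2 := by
  have hn : 0 < n := by omega
  obtain ⟨m, rfl⟩ : ∃ m, n = 2 * m := ⟨n / 2, by omega⟩
  have hc : (2 * m - 1).Coprime (4 * (2 * m)) := by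
    have h2 : (2 * m - 1).Coprime 2 := Nat.coprime_two_right.2 ⟨m - 1, by omega⟩
    refine Nat.Coprime.mul_right ?_ (Nat.Coprime.mul_right h2 ?_)
    · rw [show 4 = 2 ^ 2 by rfl]
      exact Nat.Coprime.pow_right _ h2
    · refine Nat.Coprime.of_dvd_right (Dvd.intro_left 2 rfl) ?_
      exact (Nat.coprime_self_sub_left (by omega)).2 (Nat.coprime_one_left _)
  obtain ⟨p, hp, hnp, hpa, hp4, hxy⟩ := exists_prime_sum_two_squares hn hc (by omega)
  have hpn : p + 1 ≡ 0 [MOD 2 * m] := by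
    have := (hpa.of_mul_left 4).add_right 1
    rw [show 2 * m - 1 + 1 = 2 * m by omega] at this
    exact this.trans (by simp [Nat.ModEq])
  have hpm : (m : ℤ) ∣ p + 1 := by
    exact_mod_cast (Dvd.intro_left 2 rfl).trans (Nat.modEq_zero_iff_dvd.1 hpn)
  refine sum_three_squares_of_prime hn hp hnp hxy (Nat.modEq_zero_iff_dvd.1 hpn) ?_
  have hpo : Odd p := Nat.odd_iff.2 (by omega)
  have hmo : Odd m := Nat.odd_iff.2 (by omega)
  have hp8 : p % 8 = (2 * m - 1) % 8 := by
    have : p ≡ 2 * m - 1 [MOD 8 * m] := by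
      rwa [show 8 * m = 4 * (2 * m) by ring]
    exact this.of_mul_right m
  have e : jacobiSym p m = ZMod.χ₄ m := by
    rw [← jacobiSym.at_neg_one hmo]
    apply jacobiSym.mod_left'
    rw [← Int.ModEq, Int.modEq_iff_dvd]
    obtain ⟨k, hk⟩ := hpm
    exact ⟨-k, by linear_combination -hk⟩
  push_cast
  rw [jacobiSym.mul_left, jacobiSym.quadratic_reciprocity_one_mod_four' hmo hp4, e,
    jacobiSym.at_two hpo, ZMod.χ₈_nat_eq_if_mod_eight, ZMod.χ₄_nat_eq_if_mod_four]
  have h8 : m % 4 = 1 ∨ m % 4 = 3 := by omega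
  rcases h8 with h8 | h8
  · have : p % 8 = 1 := by omega
    simp [this, h8]; omega
  · have : p % 8 = 5 := by omega
    simp [this, h8]; omega

/-- Legendre's three-square theorem for integers not divisible by `4`. -/
theorem sum_three_squares_of_mod_eight {n : ℕ} (h4 : n % 4 ≠ 0) (h7 : n % 8 ≠ 7) :
    ∃ a b c : ℤ, (n : ℤ) = a ^ 2 + b ^ 2 + c ^ 2 := by
  have : n % 4 = 1 ∨ n % 4 = 2 ∨ n % 8 = 3 := by omega
  rcases this with h | h | h
  · exact sum_three_squares_of_mod_four_eq_one h
  · exact sum_three_squares_of_mod_four_eq_two h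
  · exact sum_three_squares_of_mod_eight_eq_three h

theorem sum_three_squares_of_mod_thirtyTwo {n : ℕ} (h4 : n % 32 = 4 ∨ n % 32 = 12 ∨ n % 32 = 20) :
    ∃ a b c : ℤ, (n : ℤ) = a ^ 2 + b ^ 2 + c ^ 2 := by
  obtain ⟨m, rfl⟩ : ∃ m, n = 4 * m := ⟨n / 4, by omega⟩
  obtain ⟨a, b, c, h⟩ := sum_three_squares_of_mod_eight (n := m) (by omega) (by omega)
  exact ⟨2 * a, 2 * b, 2 * c, by push_cast; rw [h]; ring⟩

lemma not_sum_three_squares_of_mod_thirtyTwo {n : ℕ} (h : n % 32 = 28) :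
    ¬ ∃ a b c : ℤ, (n : ℤ) = a ^ 2 + b ^ 2 + c ^ 2 := by
  rintro ⟨a, b, c, habc⟩
  have key : ∀ a b c : ZMod 32, a ^ 2 + b ^ 2 + c ^ 2 ≠ 28 := by
    have sq : ∀ a : ZMod 32, a ^ 2 ∈ ({0, 1, 4, 9, 16, 17, 25} : Finset (ZMod 32)) := by decide
    have hs : ∀ x ∈ ({0, 1, 4, 9, 16, 17, 25} : Finset (ZMod 32)),
      ∀ y ∈ ({0, 1, 4, 9, 16, 17, 25} : Finset (ZMod 32)),
      ∀ z ∈ ({0, 1, 4, 9, 16, 17, 25} : Finset (ZMod 32)), x + y + z ≠ 28 := by decide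
    exact fun a b c => hs _ (sq a) _ (sq b) _ (sq c)
  apply key a b c
  have e : ((n : ℤ) : ZMod 32) = ((28 : ℤ) : ZMod 32) :=
    (ZMod.intCast_eq_intCast_iff _ _ 32).2 (by rw [Int.ModEq]; omega)
  rw [habc] at e
  exact_mod_cast e

/-! ### Recurrences for binary partitions -/

/-- Multisets of powers of two with sum `n`. -/
def binaryMultisets (n : ℕ) : Set (Multiset ℕ) :=
  {s | s.sum = n ∧ ∀ i ∈ s, ∃ k : ℕ, i = 2 ^ k}

lemma binaryMultisets_eq_image (n : ℕ) : binaryMultisets n =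
    Nat.Partition.parts '' {p : Nat.Partition n | ∀ i ∈ p.parts, ∃ k : ℕ, i = 2 ^ k} := by
  ext s
  constructor
  · rintro ⟨h1, h2⟩
    refine ⟨⟨s, fun {i} hi => ?_, h1⟩, h2, rfl⟩
    obtain ⟨k, rfl⟩ := h2 i hi
    positivity
  · rintro ⟨p, hp, rfl⟩
    exact ⟨p.parts_sum, hp⟩

lemma finite_binaryMultisets (n : ℕ) : (binaryMultisets n).Finite := by
  rw [binaryMultisets_eq_image]
  exact (Set.toFinite _).image _

lemma binaryPartition_eq_ncard (n : ℕ) : binaryPartition n = (binaryMultisets n).ncard := by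
  rw [binaryMultisets_eq_image, Set.ncard_image_of_injective _ (fun _ _ h => Nat.Partition.ext h)]
  rfl

lemma binaryMultisets_zero : binaryMultisets 0 = {0} := by
  ext s
  simp only [binaryMultisets, Set.mem_ofPred_eq, Set.mem_singleton_iff]
  constructor
  · rintro ⟨h1, h2⟩
    refine Multiset.eq_zero_of_forall_notMem fun i hi => ?_
    obtain ⟨k, hk⟩ := h2 i hi
    have := Multiset.sum_eq_zero_iff.1 h1 i hi
    rw [hk] at this
    exact absurd this (by positivity)
  · rintro rfl
    simp

lemma cons_one_mem_binaryMultisets {n : ℕ} {s : Multiset ℕ} :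
    1 ::ₘ s ∈ binaryMultisets (n + 1) ↔ s ∈ binaryMultisets n := by
  simp only [binaryMultisets, Set.mem_ofPred_eq, Multiset.sum_cons, Multiset.mem_cons,
    forall_eq_or_imp]
  constructor
  · rintro ⟨h1, -, h2⟩
    exact ⟨by omega, h2⟩
  · rintro ⟨h1, h2⟩
    exact ⟨by omega, ⟨0, rfl⟩, h2⟩

lemma map_two_mul_mem_binaryMultisets {n : ℕ} {s : Multiset ℕ} (hs : s ∈ binaryMultisets n) :
    s.map (2 * ·) ∈ binaryMultisets (2 * n) := by
  refine ⟨by rw [Multiset.sum_map_mul_left, Multiset.map_id', hs.1], fun i hi => ?_⟩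
  obtain ⟨j, hj, rfl⟩ := Multiset.mem_map.1 hi
  obtain ⟨k, rfl⟩ := hs.2 j hj
  exact ⟨k + 1, by ring⟩

lemma exists_map_two_mul_of_one_notMem {n : ℕ} {s : Multiset ℕ} (hs : s ∈ binaryMultisets n)
    (h1 : 1 ∉ s) : ∃ m, n = 2 * m ∧ ∃ u ∈ binaryMultisets m, u.map (2 * ·) = s := by
  have hpow : ∀ i ∈ s, ∃ k : ℕ, i = 2 ^ (k + 1) := by
    intro i hi
    obtain ⟨k, rfl⟩ := hs.2 i hi
    cases k with
    | zero => exact absurd hi h1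
    | succ k => exact ⟨k, rfl⟩
  have hmap : (s.map (· / 2)).map (2 * ·) = s := by
    rw [Multiset.map_map]
    conv_rhs => rw [← Multiset.map_id' s]
    refine Multiset.map_congr rfl fun i hi => ?_
    obtain ⟨k, rfl⟩ := hpow i hi
    exact Nat.mul_div_cancel' (dvd_pow_self 2 (Nat.succ_ne_zero k))
  refine ⟨(s.map (· / 2)).sum, ?_, s.map (· / 2), ⟨rfl, fun j hj => ?_⟩, hmap⟩
  · rw [← hs.1]
    conv_lhs => rw [← hmap]
    rw [Multiset.sum_map_mul_left, Multiset.map_id']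
  · obtain ⟨i, hi, rfl⟩ := Multiset.mem_map.1 hj
    obtain ⟨k, rfl⟩ := hpow i hi
    exact ⟨k, by simp [pow_succ]⟩

lemma binaryPartition_zero : binaryPartition 0 = 1 := by
  rw [binaryPartition_eq_ncard, binaryMultisets_zero, Set.ncard_singleton]

lemma ncard_cons_one (n : ℕ) :
    ((fun s : Multiset ℕ => 1 ::ₘ s) '' binaryMultisets n).ncard = binaryPartition n := by
  rw [binaryPartition_eq_ncard]
  exact Set.ncard_image_of_injective _ (fun _ _ h => (Multiset.cons_inj_right 1).1 h)

/-- A sum of powers of two that is odd uses the part 1, which can be removed. -/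
lemma binaryPartition_odd (m : ℕ) : binaryPartition (2 * m + 1) = binaryPartition (2 * m) := by
  rw [← ncard_cons_one (2 * m), binaryPartition_eq_ncard (2 * m + 1)]
  congr 1
  ext s
  constructor
  · intro hs
    by_cases h1 : 1 ∈ s
    · obtain ⟨u, rfl⟩ := Multiset.exists_cons_of_mem h1
      exact ⟨u, cons_one_mem_binaryMultisets.1 hs, rfl⟩
    · obtain ⟨k, hk, -⟩ := exists_map_two_mul_of_one_notMem hs h1
      omega
  · rintro ⟨u, hu, rfl⟩
    exact cons_one_mem_binaryMultisets.2 hu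

/-- Either a part 1 is removed, or all parts are even and are halved. -/
lemma binaryPartition_even (m : ℕ) : binaryPartition (2 * m + 2) =
    binaryPartition (2 * m + 1) + binaryPartition (m + 1) := by
  rw [← ncard_cons_one (2 * m + 1), binaryPartition_eq_ncard (2 * m + 2),
    binaryPartition_eq_ncard (m + 1),
    ← Set.ncard_image_of_injective (binaryMultisets (m + 1))
      (f := Multiset.map (2 * ·)) (Multiset.map_injective (mul_right_injective₀ two_ne_zero)),
    ← Set.ncard_union_eq ?_ ((finite_binaryMultisets _).image _)
      ((finite_binaryMultisets _).image _)]
  · congr 1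
    ext s
    constructor
    · intro hs
      by_cases h1 : 1 ∈ s
      · obtain ⟨u, rfl⟩ := Multiset.exists_cons_of_mem h1
        exact Or.inl ⟨u, cons_one_mem_binaryMultisets.1 hs, rfl⟩
      · obtain ⟨k, hk, u, hu, rfl⟩ := exists_map_two_mul_of_one_notMem hs h1
        obtain rfl : k = m + 1 := by omega
        exact Or.inr ⟨u, hu, rfl⟩
    · rintro (⟨u, hu, rfl⟩ | ⟨u, hu, rfl⟩)
      · exact cons_one_mem_binaryMultisets.2 hu
      · exact map_two_mul_mem_binaryMultisets hu
  · rw [Set.disjoint_left]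
    rintro _ ⟨u, -, rfl⟩ ⟨v, -, hv⟩
    have h1 : 1 ∈ Multiset.map (2 * ·) v := by
      rw [hv]; exact Multiset.mem_cons_self 1 u
    obtain ⟨j, -, hj⟩ := Multiset.mem_map.1 h1
    omega

/-! ### Generating functions and the recurrence for `b_3` -/

open PowerSeries in
lemma coeff_pow_eq_coloredBinaryPartition (m n : ℕ) :
    coeff n ((mk fun i => (binaryPartition i : ℤ)) ^ m) = (coloredBinaryPartition m n : ℤ) := by
  have h := coeff_prod (fun _ : Fin m => (mk fun i => (binaryPartition i : ℤ))) n Finset.univ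
  rw [Finset.prod_const, Finset.card_univ, Fintype.card_fin] at h
  rw [h, coloredBinaryPartition]
  push_cast
  refine Finset.sum_bij (fun l _ => ⇑l) ?_ ?_ ?_ ?_
  · intro l hl
    simpa using hl
  · intro a _ b _ hab
    exact DFunLike.coe_injective hab
  · intro f hf
    exact ⟨Finsupp.equivFunOnFinite.symm f, by simpa using hf, by simp⟩
  · intro l _
    simp

open PowerSeries in
lemma one_sub_X_mul_binarySeries : (1 - X) * (mk fun i => (binaryPartition i : ℤ)) =
    expand 2 two_ne_zero (mk fun i => (binaryPartition i : ℤ)) := by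
  ext n
  rw [sub_mul, one_mul, map_sub, coeff_expand]
  rcases n with _ | n
  · simp
  · rw [coeff_succ_X_mul]
    simp only [coeff_mk]
    rcases Nat.even_or_odd' n with ⟨k, rfl | rfl⟩
    · rw [if_neg (by omega), binaryPartition_odd, sub_self]
    · rw [if_pos (by omega), binaryPartition_even, show (2 * k + 1 + 1) / 2 = k + 1 by omega]
      push_cast; ring

open PowerSeries in
lemma one_sub_X_pow_mul_coloredSeries (m : ℕ) :
    (1 - X) ^ m * (mk fun i => (coloredBinaryPartition m i : ℤ)) =
    expand 2 two_ne_zero (mk fun i => (coloredBinaryPartition m i : ℤ)) := by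
  have : (mk fun i => (coloredBinaryPartition m i : ℤ)) =
      (mk fun i => (binaryPartition i : ℤ)) ^ m := by
    ext n
    rw [coeff_pow_eq_coloredBinaryPartition, coeff_mk]
  rw [this, ← mul_pow, one_sub_X_mul_binarySeries, map_pow]

open PowerSeries in
lemma coloredBinaryPartition_three_add (n : ℕ) :
    (coloredBinaryPartition 3 (n + 3) : ℤ) = 3 * coloredBinaryPartition 3 (n + 2)
      - 3 * coloredBinaryPartition 3 (n + 1) + coloredBinaryPartition 3 n +
      if 2 ∣ n + 3 then (coloredBinaryPartition 3 ((n + 3) / 2) : ℤ) else 0 := by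
  have h := congrArg (coeff (n + 3)) (one_sub_X_pow_mul_coloredSeries 3)
  rw [coeff_expand] at h
  -- Expanded into nested multiplications by `X`, so that `coeff_succ_X_mul` reads off every
  -- coefficient.
  rw [show ∀ f : ℤ⟦X⟧, (1 - X) ^ 3 * f = f - X * f - X * f - X * f + X * (X * f) + X * (X * f)
    + X * (X * f) - X * (X * (X * f)) by intro f; ring] at h
  simp only [map_sub, map_add, coeff_succ_X_mul, coeff_mk] at h
  linear_combination h

open PowerSeries in
lemma coloredBinaryPartition_three_small :
    coloredBinaryPartition 3 0 = 1 ∧ coloredBinaryPartition 3 1 = 3 ∧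
    coloredBinaryPartition 3 2 = 9 := by
  have h0 : (coloredBinaryPartition 3 0 : ℤ) = 1 := by
    rw [← coeff_pow_eq_coloredBinaryPartition]
    simp [binaryPartition_zero]
  have h := fun n => congrArg (coeff n) (one_sub_X_pow_mul_coloredSeries 3)
  simp only [coeff_expand] at h
  simp only [show ∀ f : ℤ⟦X⟧, (1 - X) ^ 3 * f = f - X * f - X * f - X * f + X * (X * f)
    + X * (X * f) + X * (X * f) - X * (X * (X * f)) by intro f; ring] at h
  have h1 := h (0 + 1)
  have h2 := h (0 + 1 + 1)
  simp only [map_sub, map_add, coeff_succ_X_mul, coeff_zero_X_mul, coeff_mk] at h1 h2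
  norm_num at h1 h2
  omega

/-! ### The residue of `b_3` modulo 32 -/

/-- The parity of the binary digit sum (the Thue–Morse sequence). -/
def digitParity (n : ℕ) : ℕ := (Nat.digits 2 n).sum % 2

/-- The indicator function of the `n` whose odd part is `3` modulo `4`. -/
def oddPartThree (n : ℕ) : ℕ :=
  if n = 0 then 0 else if n % 2 = 0 then oddPartThree (n / 2) else if n % 4 = 3 then 1 else 0
termination_by n

lemma digitParity_two_mul (n : ℕ) : digitParity (2 * n) = digitParity n := by
  rcases Nat.eq_zero_or_pos n with rfl | h
  · rfl
  · rw [digitParity, Nat.digits_def' one_lt_two (by omega)]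
    simp [digitParity]

lemma digitParity_two_mul_add_one (n : ℕ) : digitParity (2 * n + 1) + digitParity n = 1 := by
  rw [digitParity, Nat.digits_def' one_lt_two (by omega), digitParity]
  rw [show (2 * n + 1) / 2 = n by omega, show (2 * n + 1) % 2 = 1 by omega, List.sum_cons]
  omega

lemma oddPartThree_two_mul (n : ℕ) : oddPartThree (2 * n) = oddPartThree n := by
  rcases Nat.eq_zero_or_pos n with rfl | h
  · rfl
  · rw [oddPartThree, if_neg (by omega), if_pos (by omega), show 2 * n / 2 = n by omega]

lemma oddPartThree_two_mul_add_one (n : ℕ) : oddPartThree (2 * n + 1) = n % 2 := by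
  rw [oddPartThree, if_neg (by omega), if_neg (by omega)]
  split_ifs <;> omega

lemma oddPartThree_le_one (n : ℕ) : oddPartThree n ≤ 1 := by
  induction n using Nat.strong_induction_on with
  | _ n ih =>
    rw [oddPartThree]
    split_ifs
    · omega
    · exact ih _ (by omega)
    · omega
    · omega

/-- The explicit sequence congruent to `b_3(n + 4)` modulo `32`. -/
def residueSeq (n : ℕ) : ℤ :=
  (1 - 2 * digitParity (n + 4)) + 4 * (1 - 2 * digitParity (n + 3))
    - 18 * (1 - 2 * digitParity (n + 2)) + 20 * (1 - 2 * digitParity (n + 1))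
    - 7 * (1 - 2 * digitParity n)
    + 16 * (oddPartThree (n + 4) - 3 * oddPartThree (n + 3) + 3 * oddPartThree (n + 2)
      - oddPartThree (n + 1))

/-- `residueSeq n` is the coefficient of `X^(n+4)` in `(1 + 4X - 18X² + 20X³ - 7X⁴) T + 16 (1 - X)³
O`, where `T` is the series of signs `(-1)^t(n)` and `O` that of `oddPartThree`. From `T(X) = (1 -
X) T(X²)` and `O(X) = O(X²) + X³ / (1 - X⁴)`, everything becomes linear in values near `m`. The
shift by 4 suits halving: `(2m + 8) / 2 = m + 4`. -/
lemma residueSeq_recurrence_even (m : ℕ) :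
    (residueSeq (2 * m + 4) - (3 * residueSeq (2 * m + 3) - 3 * residueSeq (2 * m + 2)
      + residueSeq (2 * m + 1) + residueSeq m)) % 32 = 0 := by
  have p0 := digitParity_two_mul_add_one m
  have p1 := digitParity_two_mul (m + 1)
  have p2 := digitParity_two_mul_add_one (m + 1)
  have p3 := digitParity_two_mul (m + 2)
  have p4 := digitParity_two_mul_add_one (m + 2)
  have p5 := digitParity_two_mul (m + 3)
  have p6 := digitParity_two_mul_add_one (m + 3)
  have p7 := digitParity_two_mul (m + 4)
  have q1 := oddPartThree_two_mul (m + 1)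
  have q2 := oddPartThree_two_mul_add_one (m + 1)
  have q3 := oddPartThree_two_mul (m + 2)
  have q4 := oddPartThree_two_mul_add_one (m + 2)
  have q5 := oddPartThree_two_mul (m + 3)
  have q6 := oddPartThree_two_mul_add_one (m + 3)
  have q7 := oddPartThree_two_mul (m + 4)
  simp only [mul_add, add_assoc, Nat.reduceMul, Nat.reduceAdd] at *
  simp only [residueSeq, add_assoc, Nat.reduceAdd]
  omega

lemma residueSeq_recurrence_odd (m : ℕ) :
    (residueSeq (2 * m + 5) - (3 * residueSeq (2 * m + 4) - 3 * residueSeq (2 * m + 3)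
      + residueSeq (2 * m + 2))) % 32 = 0 := by
  have p1 := digitParity_two_mul (m + 1)
  have p2 := digitParity_two_mul_add_one (m + 1)
  have p3 := digitParity_two_mul (m + 2)
  have p4 := digitParity_two_mul_add_one (m + 2)
  have p5 := digitParity_two_mul (m + 3)
  have p6 := digitParity_two_mul_add_one (m + 3)
  have p7 := digitParity_two_mul (m + 4)
  have p8 := digitParity_two_mul_add_one (m + 4)
  have q2 := oddPartThree_two_mul_add_one (m + 1)
  have q3 := oddPartThree_two_mul (m + 2)
  have q4 := oddPartThree_two_mul_add_one (m + 2)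
  have q5 := oddPartThree_two_mul (m + 3)
  have q6 := oddPartThree_two_mul_add_one (m + 3)
  have q7 := oddPartThree_two_mul (m + 4)
  have q8 := oddPartThree_two_mul_add_one (m + 4)
  simp only [mul_add, add_assoc, Nat.reduceMul, Nat.reduceAdd] at *
  simp only [residueSeq, add_assoc, Nat.reduceAdd]
  omega

lemma coloredBinaryPartition_three_initial :
    coloredBinaryPartition 3 0 = 1 ∧ coloredBinaryPartition 3 1 = 3 ∧
    coloredBinaryPartition 3 2 = 9 ∧ coloredBinaryPartition 3 3 = 19 ∧
    coloredBinaryPartition 3 4 = 42 ∧ coloredBinaryPartition 3 5 = 78 ∧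
    coloredBinaryPartition 3 6 = 146 ∧ coloredBinaryPartition 3 7 = 246 := by
  obtain ⟨h0, h1, h2⟩ := coloredBinaryPartition_three_small
  have h3 := coloredBinaryPartition_three_add 0
  have h4 := coloredBinaryPartition_three_add 1
  have h5 := coloredBinaryPartition_three_add 2
  have h6 := coloredBinaryPartition_three_add 3
  have h7 := coloredBinaryPartition_three_add 4
  norm_num at h3 h4 h5 h6 h7
  omega

lemma coloredBinaryPartition_three_residue (n : ℕ) :
    ((coloredBinaryPartition 3 (n + 4) : ℤ) - residueSeq n) % 32 = 0 := by
  induction n using Nat.strong_induction_on with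
  | _ n ih =>
    by_cases hn : n < 4
    · obtain ⟨h0, h1, h2, h3, h4, h5, h6, h7⟩ := coloredBinaryPartition_three_initial
      have q0 : oddPartThree 0 = 0 := by rw [oddPartThree, if_pos rfl]
      have q1 := oddPartThree_two_mul_add_one 0
      have q2 := oddPartThree_two_mul 1
      have q3 := oddPartThree_two_mul_add_one 1
      have q4 := oddPartThree_two_mul 2
      have q5 := oddPartThree_two_mul_add_one 2
      have q6 := oddPartThree_two_mul 3
      have q7 := oddPartThree_two_mul_add_one 3
      norm_num at q1 q2 q3 q4 q5 q6 q7
      interval_cases n <;> simp only [residueSeq, digitParity] <;> norm_num <;> omega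
    · rcases Nat.even_or_odd' n with ⟨k, rfl | rfl⟩
      · obtain ⟨m, rfl⟩ : ∃ m, k = m + 2 := ⟨k - 2, by omega⟩
        have hr := residueSeq_recurrence_even m
        have hb := coloredBinaryPartition_three_add (2 * m + 5)
        rw [if_pos (by omega), show (2 * m + 5 + 3) / 2 = m + 4 by omega] at hb
        have i0 := ih m (by omega)
        have i1 := ih (2 * m + 1) (by omega)
        have i2 := ih (2 * m + 2) (by omega)
        have i3 := ih (2 * m + 3) (by omega)
        simp only [mul_add, add_assoc, Nat.reduceMul, Nat.reduceAdd] at *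
        omega
      · obtain ⟨m, rfl⟩ : ∃ m, k = m + 2 := ⟨k - 2, by omega⟩
        have hr := residueSeq_recurrence_odd m
        have hb := coloredBinaryPartition_three_add (2 * m + 6)
        rw [if_neg (by omega)] at hb
        have i1 := ih (2 * m + 2) (by omega)
        have i2 := ih (2 * m + 3) (by omega)
        have i3 := ih (2 * m + 4) (by omega)
        simp only [mul_add, add_assoc, Nat.reduceMul, Nat.reduceAdd] at *
        omega

/-! ### Blocks of four consecutive integers -/

lemma digitParity_le_one (n : ℕ) : digitParity n ≤ 1 := by
  rw [digitParity]; omega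

lemma mem_exceptionalSet_iff (n : ℕ) : n ∈ exceptionalSet 3 ↔
    ¬ ∃ x y z : ℤ, (coloredBinaryPartition 3 n : ℤ) = x ^ 2 + y ^ 2 + z ^ 2 := Iff.rfl

lemma notMem_exceptionalSet_of_lt_four {n : ℕ} (hn : n < 4) : n ∉ exceptionalSet 3 := by
  obtain ⟨h0, h1, h2, h3, -⟩ := coloredBinaryPartition_three_initial
  rw [mem_exceptionalSet_iff, not_not]
  apply sum_three_squares_of_mod_eight <;> interval_cases n <;> omega

lemma digitParity_four_mul_add (j : ℕ) :
    digitParity (4 * j) = digitParity j ∧ digitParity (4 * j + 1) = 1 - digitParity j ∧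
    digitParity (4 * j + 2) = 1 - digitParity j ∧ digitParity (4 * j + 3) = digitParity j := by
  have p0 := digitParity_two_mul j
  have p1 := digitParity_two_mul_add_one j
  have p2 := digitParity_two_mul (2 * j)
  have p3 := digitParity_two_mul_add_one (2 * j)
  have p4 := digitParity_two_mul (2 * j + 1)
  have p5 := digitParity_two_mul_add_one (2 * j + 1)
  simp only [mul_add, add_assoc, ← mul_assoc, Nat.reduceMul, Nat.reduceAdd] at *
  omega

lemma oddPartThree_four_mul_add (j : ℕ) :
    oddPartThree (4 * j) = oddPartThree j ∧ oddPartThree (4 * j + 1) = 0 ∧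
    oddPartThree (4 * j + 2) = j % 2 ∧ oddPartThree (4 * j + 3) = 1 := by
  have q0 := oddPartThree_two_mul j
  have q1 := oddPartThree_two_mul_add_one j
  have q2 := oddPartThree_two_mul (2 * j)
  have q3 := oddPartThree_two_mul_add_one (2 * j)
  have q4 := oddPartThree_two_mul (2 * j + 1)
  have q5 := oddPartThree_two_mul_add_one (2 * j + 1)
  simp only [mul_add, add_assoc, ← mul_assoc, Nat.reduceMul, Nat.reduceAdd] at *
  omega

lemma residueSeq_four_mul_add {j r : ℕ} (hr : r < 4) :
    (digitParity (j + 1) ≠ digitParity j → residueSeq (4 * j + r) % 4 = 2) ∧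
    (digitParity (j + 1) = digitParity j →
      (r = (if oddPartThree (j + 1) = 0 then digitParity (j + 1) else 3 - digitParity (j + 1)) →
        residueSeq (4 * j + r) % 32 = 28) ∧
      (r ≠ (if oddPartThree (j + 1) = 0 then digitParity (j + 1) else 3 - digitParity (j + 1)) →
        residueSeq (4 * j + r) % 8 = 4 ∧ residueSeq (4 * j + r) % 32 ≠ 28)) := by
  have a1 := digitParity_le_one (j + 1)
  have a2 := oddPartThree_le_one (j + 1)
  obtain ⟨p0, p1, p2, p3⟩ := digitParity_four_mul_add j
  obtain ⟨p4, p5, p6, p7⟩ := digitParity_four_mul_add (j + 1)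
  -- The terms of index `2k` and `2k + 1` always differ, so repetitions start at odd `j`; this fixes
  -- `oddPartThree` at `4j + 2` and `4j + 6`.
  have hj : digitParity (j + 1) = digitParity j → j % 2 = 1 := by
    intro h
    by_contra hne
    obtain ⟨k, rfl⟩ : ∃ k, j = 2 * k := ⟨j / 2, by omega⟩
    have := digitParity_two_mul k
    have := digitParity_two_mul_add_one k
    omega
  obtain ⟨-, q1, q2, q3⟩ := oddPartThree_four_mul_add j
  obtain ⟨q4, q5, q6, q7⟩ := oddPartThree_four_mul_add (j + 1)
  simp only [mul_add, add_assoc, Nat.reduceMul, Nat.reduceAdd] at *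
  by_cases h : digitParity (j + 1) = digitParity j
  · refine ⟨fun hne => absurd h hne, fun _ => ?_⟩
    have hj := hj h
    rw [← h] at p0 p1 p2 p3
    clear h
    rcases Nat.le_one_iff_eq_zero_or_eq_one.1 a1 with h1 | h1 <;>
    rcases Nat.le_one_iff_eq_zero_or_eq_one.1 a2 with h2 | h2 <;>
    rw [h1] at p0 p1 p2 p3 p4 p5 p6 p7 <;> rw [h2] at q4 <;> rw [h1, h2] <;>
    interval_cases r <;>
    simp only [residueSeq, add_assoc, Nat.reduceAdd, add_zero, p0, p1, p2, p3, p4, p5, p6, p7,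
      q1, q2, q3, q4, q5, q6, q7, hj] <;>
    norm_num <;> omega
  · refine ⟨fun _ => ?_, fun he => absurd he h⟩
    have a0 := digitParity_le_one j
    have hs : digitParity j = 1 - digitParity (j + 1) := by omega
    rw [hs] at p0 p1 p2 p3
    clear h hj hs a0
    rcases Nat.le_one_iff_eq_zero_or_eq_one.1 a1 with h1 | h1 <;>
    rw [h1] at p0 p1 p2 p3 p4 p5 p6 p7 <;>
    interval_cases r <;>
    simp only [residueSeq, add_assoc, Nat.reduceAdd, add_zero, p0, p1, p2, p3, p4, p5, p6, p7,
      q1, q2, q3, q4, q5, q6, q7] <;>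
    norm_num <;> omega

/-- The exceptional set is empty on a block of length four at which the Thue–Morse sequence
changes. -/
lemma notMem_exceptionalSet_of_ne {j r : ℕ} (hr : r < 4)
    (h : digitParity (j + 1) ≠ digitParity j) : 4 * (j + 1) + r ∉ exceptionalSet 3 := by
  rw [mem_exceptionalSet_iff, not_not]
  have h1 := (residueSeq_four_mul_add hr).1 h
  have h2 := coloredBinaryPartition_three_residue (4 * j + r)
  rw [show 4 * (j + 1) + r = 4 * j + r + 4 by ring]
  exact sum_three_squares_of_mod_four_eq_two (by omega)

/-- The exceptional set has exactly one element in any other block of length four. -/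
lemma exists_mem_exceptionalSet_iff {j : ℕ} (h : digitParity (j + 1) = digitParity j) :
    ∃ s < 4, ∀ r < 4, 4 * (j + 1) + r ∈ exceptionalSet 3 ↔ r = s := by
  refine ⟨if oddPartThree (j + 1) = 0 then digitParity (j + 1) else 3 - digitParity (j + 1), ?_,
    fun r hr => ?_⟩
  · have := digitParity_le_one (j + 1)
    split_ifs <;> omega
  · have h1 := (residueSeq_four_mul_add hr).2 h
    have h2 := coloredBinaryPartition_three_residue (4 * j + r)
    rw [show 4 * (j + 1) + r = 4 * j + r + 4 by ring, mem_exceptionalSet_iff]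
    constructor
    · intro hn
      by_contra hne
      have h3 := h1.2 hne
      exact hn (sum_three_squares_of_mod_thirtyTwo (by omega))
    · intro he
      have h3 := h1.1 he
      exact not_sum_three_squares_of_mod_thirtyTwo (by omega)

/-! ### Counting repetitions in the Thue–Morse sequence -/

open scoped Classical in
/-- The number of elements of `S_3` below `n`. -/
noncomputable def exceptionalBelow (n : ℕ) : ℕ := Nat.count (· ∈ exceptionalSet 3) n

/-- The number of `j < n` with `t (j + 1) = t j`, where `t` is the Thue–Morse sequence. -/
def repeatCount (n : ℕ) : ℕ := Nat.count (fun j => digitParity (j + 1) = digitParity j) n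

lemma exceptionalCount_three_eq {x : ℝ} (hx : 0 ≤ x) :
    exceptionalCount 3 x = exceptionalBelow (⌊x⌋₊ + 1) := by
  classical
  rw [exceptionalBelow, Nat.count_eq_card_filter_range, exceptionalCount,
    ← Set.ncard_coe_finset]
  congr 1
  ext n
  simp [← Nat.le_floor_iff hx, and_comm]

lemma exceptionalBelow_mono : Monotone exceptionalBelow := by
  classical
  intro a b h
  unfold exceptionalBelow
  convert Nat.count_monotone (· ∈ exceptionalSet 3) h

lemma repeatCount_succ (n : ℕ) : repeatCount (n + 1) =
    repeatCount n + if digitParity (n + 1) = digitParity n then 1 else 0 :=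
  Nat.count_succ _ n

/-- The first block has no exceptional element, and the block starting at `4(j+1)` has one exactly
when the pair `(j, j+1)` is a repetition. -/
lemma exceptionalBelow_four_mul (j : ℕ) : exceptionalBelow (4 * (j + 1)) = repeatCount j := by
  classical
  induction j with
  | zero =>
    have h0 := notMem_exceptionalSet_of_lt_four (n := 0) (by omega)
    have h1 := notMem_exceptionalSet_of_lt_four (n := 1) (by omega)
    have h2 := notMem_exceptionalSet_of_lt_four (n := 2) (by omega)
    have h3 := notMem_exceptionalSet_of_lt_four (n := 3) (by omega)
    simp [exceptionalBelow, repeatCount, Nat.count_succ, h0, h1, h2, h3]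
  | succ j ih =>
    have hs : exceptionalBelow (4 * (j + 1 + 1)) = exceptionalBelow (4 * (j + 1)) +
        Nat.count (fun r => 4 * (j + 1) + r ∈ exceptionalSet 3) 4 := by
      unfold exceptionalBelow
      rw [show 4 * (j + 1 + 1) = 4 * (j + 1) + 4 by ring, Nat.count_add]
    rw [hs, ih, repeatCount_succ]
    congr 1
    by_cases h : digitParity (j + 1) = digitParity j
    · rw [if_pos h]
      obtain ⟨s, hs4, hs⟩ := exists_mem_exceptionalSet_iff h
      have h0 := hs 0 (by omega)
      have h1 := hs 1 (by omega)
      have h2 := hs 2 (by omega)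
      have h3 := hs 3 (by omega)
      simp only [Nat.count_succ, Nat.count_zero, h0, h1, h2, h3]
      interval_cases s <;> simp
    · rw [if_neg h]
      have h0 := notMem_exceptionalSet_of_ne (r := 0) (by omega) h
      have h1 := notMem_exceptionalSet_of_ne (r := 1) (by omega) h
      have h2 := notMem_exceptionalSet_of_ne (r := 2) (by omega) h
      have h3 := notMem_exceptionalSet_of_ne (r := 3) (by omega) h
      simp only [Nat.count_succ, Nat.count_zero, h0, h1, h2, h3]
      simp

lemma exceptionalBelow_le {n j : ℕ} (h : n ≤ 4 * (j + 1)) : exceptionalBelow n ≤ repeatCount j :=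
  (exceptionalBelow_mono h).trans (exceptionalBelow_four_mul j).le

lemma le_exceptionalBelow {n j : ℕ} (h : 4 * (j + 1) ≤ n) : repeatCount j ≤ exceptionalBelow n :=
  (exceptionalBelow_four_mul j).ge.trans (exceptionalBelow_mono h)

/-- From `4M` on, the sequence reads `t, 1-t, 1-t, t` with `t = t(M)`: one repetition inside, and
one at the end exactly when `t(M+1) = t(M)`. -/
lemma repeatCount_four_mul_add (M : ℕ) :
    repeatCount (4 * M) = repeatCount M + M ∧ repeatCount (4 * M + 1) = repeatCount M + M ∧
    repeatCount (4 * M + 2) = repeatCount M + M + 1 ∧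
    repeatCount (4 * M + 3) = repeatCount M + M + 1 := by
  have step (M : ℕ) : repeatCount (4 * M + 1) = repeatCount (4 * M) ∧
      repeatCount (4 * M + 2) = repeatCount (4 * M) + 1 ∧
      repeatCount (4 * M + 3) = repeatCount (4 * M) + 1 := by
    obtain ⟨p0, p1, p2, p3⟩ := digitParity_four_mul_add M
    have := digitParity_le_one M
    have h1 := repeatCount_succ (4 * M)
    have h2 : repeatCount (4 * M + 2) = repeatCount (4 * M + 1) +
        if digitParity (4 * M + 2) = digitParity (4 * M + 1) then 1 else 0 := repeatCount_succ _
    have h3 : repeatCount (4 * M + 3) = repeatCount (4 * M + 2) +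
        if digitParity (4 * M + 3) = digitParity (4 * M + 2) then 1 else 0 := repeatCount_succ _
    rw [p1, p0, if_neg (by omega)] at h1
    rw [p2, p1, if_pos rfl] at h2
    rw [p3, p2, if_neg (by omega)] at h3
    omega
  have zero_case : repeatCount (4 * M) = repeatCount M + M := by
    induction M with
    | zero => rfl
    | succ M ih =>
      have h := step M
      have h4 := repeatCount_succ (4 * M + 3)
      rw [show 4 * M + 3 + 1 = 4 * (M + 1) by ring, (digitParity_four_mul_add (M + 1)).1,
        (digitParity_four_mul_add M).2.2.2] at h4
      have h1 := repeatCount_succ M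
      omega
  have h := step M
  omega

/-- Appending a base 4 digit `r` to `N` changes `3 * repeatCount N - N` by 0, -1, 1, 0 for `r = 0,
1, 2, 3`. The worst cases are `N = 2...2` and `N = 1...1`, whence `4^k ≤ 2N` and `4^k ≤ 4N`. -/
lemma three_mul_repeatCount_bounds (N : ℕ) (hN : 0 < N) :
    (∃ k, 4 ^ k ≤ 2 * N ∧ 3 * repeatCount N ≤ N + k) ∧
    (∃ k, 4 ^ k ≤ 4 * N ∧ N ≤ 3 * repeatCount N + k) := by
  induction N using Nat.strong_induction_on with
  | _ N ih =>
    rcases Nat.eq_zero_or_pos (N / 4) with h0 | hpos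
    · have h := repeatCount_four_mul_add 0
      have hz : repeatCount 0 = 0 := rfl
      simp only [mul_zero, zero_add, hz, true_and] at h
      obtain rfl | rfl | rfl : N = 1 ∨ N = 2 ∨ N = 3 := by omega
      · exact ⟨⟨0, by norm_num, by omega⟩, ⟨1, by norm_num, by omega⟩⟩
      · exact ⟨⟨1, by norm_num, by omega⟩, ⟨0, by norm_num, by omega⟩⟩
      · exact ⟨⟨0, by norm_num, by omega⟩, ⟨0, by norm_num, by omega⟩⟩
    · obtain ⟨⟨k, hk, hk'⟩, ⟨i, hi, hi'⟩⟩ := ih (N / 4) (by omega) hpos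
      have h := repeatCount_four_mul_add (N / 4)
      obtain ⟨r, hr, hNr⟩ : ∃ r < 4, N = 4 * (N / 4) + r := ⟨N % 4, by omega, by omega⟩
      generalize N / 4 = M at *
      subst hNr
      constructor
      · by_cases h2 : r = 2
        · exact ⟨k + 1, by rw [pow_succ]; omega, by subst h2; omega⟩
        · refine ⟨k, by omega, ?_⟩
          interval_cases r <;> (try rw [add_zero]) <;> omega
      · by_cases h2 : r = 1
        · exact ⟨i + 1, by rw [pow_succ]; omega, by subst h2; omega⟩
        · refine ⟨i, by omega, ?_⟩
          interval_cases r <;> (try rw [add_zero]) <;> omega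

/-! ### Logarithmic bounds and density -/

lemma two_mul_le_logb_of_pow_le {k : ℕ} {y : ℝ} (h : (4 : ℝ) ^ k ≤ y) :
    2 * (k : ℝ) ≤ Real.logb 2 y := by
  rw [Real.le_logb_iff_rpow_le one_lt_two (lt_of_lt_of_le (by positivity) h)]
  rw [Real.rpow_mul (by norm_num), Real.rpow_natCast]
  norm_num [h]

lemma logb_le_of_le_pow {k : ℕ} {y : ℝ} (hy : 0 < y) (h : y ≤ (4 : ℝ) ^ k) :
    Real.logb 2 y ≤ 2 * (k : ℝ) := by
  rw [Real.logb_le_iff_le_rpow one_lt_two hy]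
  rw [Real.rpow_mul (by norm_num), Real.rpow_natCast]
  norm_num [h]

lemma logb_two_mul {y : ℝ} (hy : 0 < y) : Real.logb 2 (2 * y) = 1 + Real.logb 2 y := by
  rw [Real.logb_mul two_ne_zero hy.ne', Real.logb_self_eq_one one_lt_two]

lemma logb_four_mul {y : ℝ} (hy : 0 < y) : Real.logb 2 (4 * y) = 2 + Real.logb 2 y := by
  rw [show 4 * y = 2 * (2 * y) by ring, logb_two_mul (by positivity), logb_two_mul hy]
  ring

lemma repeatCount_le_logb {N : ℕ} (hN : 0 < N) :
    (repeatCount N : ℝ) ≤ N / 3 + 1 / 6 + Real.logb 2 N / 6 := by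
  obtain ⟨⟨k, hk, h⟩, -⟩ := three_mul_repeatCount_bounds N hN
  have h1 := two_mul_le_logb_of_pow_le (y := 2 * (N : ℝ)) (by exact_mod_cast hk)
  rw [logb_two_mul (by exact_mod_cast hN)] at h1
  have h2 : 3 * (repeatCount N : ℝ) ≤ N + k := by exact_mod_cast h
  linarith

lemma logb_le_repeatCount {N : ℕ} (hN : 0 < N) :
    (N : ℝ) / 3 - 1 / 3 - Real.logb 2 N / 6 ≤ repeatCount N := by
  obtain ⟨-, ⟨k, hk, h⟩⟩ := three_mul_repeatCount_bounds N hN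
  have h1 := two_mul_le_logb_of_pow_le (y := 4 * (N : ℝ)) (by exact_mod_cast hk)
  rw [logb_four_mul (by exact_mod_cast hN)] at h1
  have h2 : (N : ℝ) ≤ 3 * (repeatCount N : ℝ) + k := by exact_mod_cast h
  linarith

theorem exceptionalCount_three_lower {x : ℝ} (hx : 1 ≤ x) :
    -(1 / 6 : ℝ) * Real.logb 2 x - 7 / 12 < (exceptionalCount 3 x : ℝ) - x / 12 := by
  have hx0 : 0 ≤ x := by linarith
  rw [exceptionalCount_three_eq hx0]
  have hlog : 0 ≤ Real.logb 2 x := Real.logb_nonneg one_lt_two hx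
  have hlt := Nat.lt_floor_add_one x
  have hle := Nat.floor_le hx0
  set n := ⌊x⌋₊ with hn
  have hS : (0 : ℝ) ≤ (exceptionalBelow (n + 1) : ℝ) := Nat.cast_nonneg _
  obtain ⟨q, r, hr, hnq⟩ : ∃ q r, r < 4 ∧ n = 4 * q + r := ⟨n / 4, n % 4, by omega, by omega⟩
  rw [hnq] at hS hlt hle ⊢
  push_cast at hlt hle
  have hr' : (r : ℝ) ≤ 3 := by exact_mod_cast Nat.le_of_lt_succ hr
  have hr0 : (0 : ℝ) ≤ r := Nat.cast_nonneg r
  rcases Nat.eq_zero_or_pos q with rfl | hq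
  · push_cast at hlt
    linarith
  have hq' : (0 : ℝ) < q := by exact_mod_cast hq
  have hlogq : 2 + Real.logb 2 q ≤ Real.logb 2 x := by
    rw [← logb_four_mul hq']
    exact Real.logb_le_logb_of_le one_lt_two (by positivity) (by linarith)
  -- Only for `r = 3` is the last block complete. Otherwise it is dropped, and `x < 4(N+1) + 3`
  -- yields the constant 7/12.
  by_cases h3 : r = 3
  · have h1 := logb_le_repeatCount hq
    have h2 : (repeatCount q : ℝ) ≤ exceptionalBelow (4 * q + r + 1) := by
      exact_mod_cast le_exceptionalBelow (by omega)
    linarith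
  · have hr2 : (r : ℝ) ≤ 2 := by exact_mod_cast (by omega : r ≤ 2)
    obtain ⟨N, rfl⟩ : ∃ N, q = N + 1 := ⟨q - 1, by omega⟩
    push_cast at *
    have h2 : (repeatCount N : ℝ) ≤ exceptionalBelow (4 * (N + 1) + r + 1) := by
      exact_mod_cast le_exceptionalBelow (by omega)
    rcases Nat.eq_zero_or_pos N with rfl | hN
    · push_cast at *
      linarith
    · have h1 := logb_le_repeatCount hN
      have hN' : (0 : ℝ) < N := by exact_mod_cast hN
      have : Real.logb 2 N ≤ Real.logb 2 (N + 1) :=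
        Real.logb_le_logb_of_le one_lt_two hN' (by linarith)
      linarith

theorem exceptionalCount_three_upper {x : ℝ} (hx : 1 ≤ x) (hx2 : 2 ≤ x + 2 * Real.logb 2 x) :
    (exceptionalCount 3 x : ℝ) - x / 12 ≤ (1 / 6 : ℝ) * Real.logb 2 x - 1 / 6 := by
  have hx0 : 0 ≤ x := by linarith
  rw [exceptionalCount_three_eq hx0]
  have hle := Nat.floor_le hx0
  set n := ⌊x⌋₊ with hn
  have hS : (exceptionalBelow (n + 1) : ℝ) ≤ repeatCount (n / 4) := by
    exact_mod_cast exceptionalBelow_le (by omega)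
  -- For `x < 4` the count is 0, and the claim is exactly the hypothesis `hx2`.
  rcases Nat.eq_zero_or_pos (n / 4) with h0 | hq
  · rw [h0, repeatCount, Nat.count_zero, Nat.cast_zero] at hS
    linarith
  have hq' : (0 : ℝ) < (n / 4 : ℕ) := by exact_mod_cast hq
  have hnx : 4 * ((n / 4 : ℕ) : ℝ) ≤ x := by
    refine le_trans ?_ hle
    exact_mod_cast Nat.mul_div_le n 4
  have hlogq : 2 + Real.logb 2 (n / 4 : ℕ) ≤ Real.logb 2 x := by
    rw [← logb_four_mul hq']
    exact Real.logb_le_logb_of_le one_lt_two (by positivity) hnx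
  have h1 := repeatCount_le_logb hq
  linarith

theorem tendsto_exceptionalCount_three_div :
    Tendsto (fun x : ℝ => (exceptionalCount 3 x : ℝ) / x) atTop (𝓝 (1 / 12)) := by
  have hlog : Tendsto (fun x : ℝ => Real.logb 2 x / x) atTop (𝓝 0) := by
    have h := (Real.isLittleO_log_id_atTop.tendsto_div_nhds_zero).div_const (Real.log 2)
    rw [zero_div] at h
    refine h.congr fun x => ?_
    rw [Real.logb, id, div_right_comm]
  have hinv : Tendsto (fun x : ℝ => x⁻¹) atTop (𝓝 0) := tendsto_inv_atTop_zero
  have hlow : Tendsto (fun x : ℝ => 1 / 12 - 1 / 6 * (Real.logb 2 x / x) - 7 / 12 * x⁻¹) atTop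
      (𝓝 (1 / 12)) := by
    simpa only [mul_zero, add_zero, sub_zero] using (tendsto_const_nhds (x := (1 / 12 : ℝ))).sub (hlog.const_mul (1 / 6))
      |>.sub (hinv.const_mul (7 / 12))
  have hup : Tendsto (fun x : ℝ => 1 / 12 + 1 / 6 * (Real.logb 2 x / x) - 1 / 6 * x⁻¹) atTop
      (𝓝 (1 / 12)) := by
    simpa only [mul_zero, add_zero, sub_zero] using (tendsto_const_nhds (x := (1 / 12 : ℝ))).add (hlog.const_mul (1 / 6))
      |>.sub (hinv.const_mul (1 / 6))
  refine tendsto_of_tendsto_of_tendsto_of_le_of_le' hlow hup ?_ ?_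
  · filter_upwards [eventually_ge_atTop 1] with x hx
    have h := exceptionalCount_three_lower hx
    have hx0 : 0 < x := by linarith
    rw [le_div_iff₀ hx0]
    field_simp
    linarith
  · filter_upwards [eventually_ge_atTop 2] with x hx
    have hl := Real.logb_nonneg one_lt_two (by linarith : 1 ≤ x)
    have h := exceptionalCount_three_upper (x := x) (by linarith) (by linarith)
    have hx0 : 0 < x := by linarith
    rw [div_le_iff₀ hx0]
    field_simp
    linarith

/-! ### Sequences attaining the logarithmic order -/

/-- The discrepancy of `a l / 4` is `6cl = ±l`, and `logb 2 (a l) = 2l + O(1)`; the two sides differ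
by a bounded amount while the logarithm tends to infinity. -/
lemma isEquivalent_exceptionalCount_three (a : ℕ → ℕ) (c : ℝ) (hc : |c| = 1 / 6)
    (h4 : ∀ l, 4 ∣ a l) (hD : ∀ l, 3 * (repeatCount (a l / 4) : ℝ) - a l / 4 = 6 * c * l)
    (hlow : ∀ l, 1 ≤ l → 4 ^ l ≤ a l) (hup : ∀ l, a l ≤ 4 ^ (l + 2)) :
    Asymptotics.IsEquivalent atTop
      (fun l : ℕ => (exceptionalCount 3 (a l : ℝ) : ℝ) - (a l : ℝ) / 12)
      (fun l : ℕ => c * Real.logb 2 (a l : ℝ)) := by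
  have hL : ∀ l : ℕ, 1 ≤ l → 2 * (l : ℝ) ≤ Real.logb 2 (a l) ∧ Real.logb 2 (a l) ≤ 2 * l + 4 := by
    intro l hl
    have h1 : (4 : ℝ) ^ l ≤ a l := by exact_mod_cast hlow l hl
    have h2 : (a l : ℝ) ≤ 4 ^ (l + 2) := by exact_mod_cast hup l
    have h3 := logb_le_of_le_pow (lt_of_lt_of_le (by positivity) h1) h2
    push_cast at h3
    exact ⟨two_mul_le_logb_of_pow_le h1, by linarith⟩
  have hO : ((fun l : ℕ => (exceptionalCount 3 (a l : ℝ) : ℝ) - (a l : ℝ) / 12) -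
      fun l : ℕ => c * Real.logb 2 (a l : ℝ)) =O[atTop] (fun _ => (1 : ℝ)) := by
    refine Asymptotics.IsBigO.of_bound 2 ?_
    filter_upwards [eventually_ge_atTop 1] with l hl
    obtain ⟨h1, h2⟩ := hL l hl
    have hD := hD l
    have hpos : 0 < a l := lt_of_lt_of_le (by positivity) (hlow l hl)
    obtain ⟨j, hj⟩ := h4 l
    obtain ⟨N, rfl⟩ : ∃ N, j = N + 1 := ⟨j - 1, by omega⟩
    have hS1 : exceptionalBelow (a l + 1) ≤ repeatCount (N + 1) := exceptionalBelow_le (by omega)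
    have hS2 : repeatCount N ≤ exceptionalBelow (a l + 1) := le_exceptionalBelow (by omega)
    have hsucc : repeatCount (N + 1) ≤ repeatCount N + 1 := by
      rw [repeatCount_succ]; split_ifs <;> omega
    rw [show a l / 4 = N + 1 by omega] at hD
    rw [Pi.sub_apply, exceptionalCount_three_eq (Nat.cast_nonneg _), Nat.floor_natCast]
    have hS1' : (exceptionalBelow (a l + 1) : ℝ) ≤ repeatCount (N + 1) := by exact_mod_cast hS1
    have hS2' : (repeatCount (N + 1) : ℝ) ≤ exceptionalBelow (a l + 1) + 1 := by
      exact_mod_cast hsucc.trans (by omega)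
    rw [norm_one, mul_one, Real.norm_eq_abs]
    have e : (exceptionalBelow (a l + 1) : ℝ) - a l / 12 - c * Real.logb 2 (a l) =
        (exceptionalBelow (a l + 1) - repeatCount (N + 1)) - c * (Real.logb 2 (a l) - 2 * l) := by
      linear_combination (1 / 3 : ℝ) * hD
    have b1 : |(exceptionalBelow (a l + 1) : ℝ) - repeatCount (N + 1)| ≤ 1 := by
      rw [abs_le]; constructor <;> linarith
    have b2 : |c * (Real.logb 2 (a l) - 2 * l)| ≤ 1 := by
      rw [abs_mul, hc, abs_of_nonneg (by linarith)]
      linarith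
    rw [e]
    exact (abs_sub _ _).trans (by linarith)
  refine hO.trans_isLittleO ?_
  rw [Asymptotics.isLittleO_const_left]
  right
  refine tendsto_atTop_mono' atTop (f₁ := fun l : ℕ => (1 / 3 : ℝ) * l) ?_
    (tendsto_natCast_atTop_atTop.const_mul_atTop (by norm_num))
  filter_upwards [eventually_ge_atTop 1] with l hl
  obtain ⟨h1, -⟩ := hL l hl
  have hl0 : (0 : ℝ) ≤ l := Nat.cast_nonneg l
  rw [Function.comp_apply, norm_mul, Real.norm_eq_abs, Real.norm_eq_abs, hc,
    abs_of_nonneg (by linarith)]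
  linarith

/-- The sequence `m_0 = 0`, `m_{l+1} = 4 m_l + d`. -/
def affineSeq (d : ℕ) : ℕ → ℕ
  | 0 => 0
  | l + 1 => 4 * affineSeq d l + d

lemma strictMono_affineSeq {d : ℕ} (hd : 0 < d) : StrictMono (affineSeq d) :=
  strictMono_nat_of_lt_succ fun l => by rw [affineSeq]; omega

lemma four_dvd_affineSeq {d : ℕ} (hd : 4 ∣ d) (l : ℕ) : 4 ∣ affineSeq d l := by
  induction l with
  | zero => exact dvd_zero 4
  | succ l ih => rw [affineSeq]; omega

lemma four_pow_le_affineSeq {d : ℕ} (hd : 4 ≤ d) (l : ℕ) : 4 ^ (l + 1) ≤ affineSeq d (l + 1) := by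
  induction l with
  | zero => simpa [affineSeq] using hd
  | succ l ih => rw [affineSeq, pow_succ]; omega

lemma affineSeq_le_four_pow {d : ℕ} (hd : d ≤ 16) (l : ℕ) : affineSeq d l ≤ 4 ^ (l + 2) := by
  suffices affineSeq d l + 16 ≤ 4 ^ (l + 2) by omega
  induction l with
  | zero => simp [affineSeq]
  | succ l ih => rw [affineSeq, show l + 1 + 2 = (l + 2) + 1 by ring, pow_succ]; omega

/-- In base 4, `affineSeq 8 l / 4` consists of `l` digits 2. -/
lemma three_mul_repeatCount_affineSeq_eight (l : ℕ) :
    3 * repeatCount (affineSeq 8 l / 4) = affineSeq 8 l / 4 + l := by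
  induction l with
  | zero => rfl
  | succ l ih =>
    have h4 := four_dvd_affineSeq (d := 8) (by norm_num) l
    rw [affineSeq, show (4 * affineSeq 8 l + 8) / 4 = 4 * (affineSeq 8 l / 4) + 2 by omega,
      (repeatCount_four_mul_add _).2.2.1]
    omega

/-- In base 4, `affineSeq 16 l / 16` consists of `l` digits 1; the further digit 0 of `affineSeq 16
l / 4` leaves the discrepancy unchanged. -/
lemma three_mul_repeatCount_affineSeq_sixteen (l : ℕ) :
    3 * repeatCount (affineSeq 16 l / 4) + l = affineSeq 16 l / 4 := by
  have key (l : ℕ) : 16 ∣ affineSeq 16 l ∧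
      3 * repeatCount (affineSeq 16 l / 16) + l = affineSeq 16 l / 16 := by
    induction l with
    | zero => exact ⟨dvd_zero _, rfl⟩
    | succ l ih =>
      obtain ⟨h16, ih⟩ := ih
      rw [affineSeq, show (4 * affineSeq 16 l + 16) / 16 = 4 * (affineSeq 16 l / 16) + 1 by omega,
        (repeatCount_four_mul_add _).2.1]
      omega
  obtain ⟨h16, h⟩ := key l
  rw [show affineSeq 16 l / 4 = 4 * (affineSeq 16 l / 16) by omega,
    (repeatCount_four_mul_add _).1]
  omega

lemma isEquivalent_affineSeq {d : ℕ} (hd : 4 ∣ d) (h4 : 4 ≤ d) (h16 : d ≤ 16) (c : ℝ)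
    (hc : |c| = 1 / 6) (hD : ∀ l, 3 * (repeatCount (affineSeq d l / 4) : ℝ) -
      (affineSeq d l / 4 : ℕ) = 6 * c * l) :
    Asymptotics.IsEquivalent atTop
      (fun l : ℕ => (exceptionalCount 3 (affineSeq d l : ℝ) : ℝ) - (affineSeq d l : ℝ) / 12)
      (fun l : ℕ => c * Real.logb 2 (affineSeq d l : ℝ)) := by
  refine isEquivalent_exceptionalCount_three _ c hc (four_dvd_affineSeq hd) (fun l => ?_)
    (fun l hl => ?_) (affineSeq_le_four_pow h16)
  · rw [← hD, Nat.cast_div (four_dvd_affineSeq hd l) (by norm_num)]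
    norm_num
  · obtain ⟨k, rfl⟩ : ∃ k, l = k + 1 := ⟨l - 1, by omega⟩
    exact four_pow_le_affineSeq h4 k

theorem mainTheorem6 :
    (∀ x : ℝ, 1 ≤ x →
      -(1 / 6 : ℝ) * Real.logb 2 x - 7 / 12 < (exceptionalCount 3 x : ℝ) - x / 12) ∧
    (∀ x : ℝ, 1 ≤ x → 2 ≤ x + 2 * Real.logb 2 x →
      (exceptionalCount 3 x : ℝ) - x / 12 ≤ (1 / 6 : ℝ) * Real.logb 2 x - 1 / 6) ∧
    Tendsto (fun x : ℝ => (exceptionalCount 3 x : ℝ) / x) atTop (𝓝 (1 / 12)) ∧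
    (∃ m : ℕ → ℕ, StrictMono m ∧ m 0 = 0 ∧ (∀ l, m (l + 1) = 4 * m l + 8) ∧
      Asymptotics.IsEquivalent atTop
        (fun l : ℕ => (exceptionalCount 3 (m l : ℝ) : ℝ) - (m l : ℝ) / 12)
        (fun l : ℕ => (1 / 6 : ℝ) * Real.logb 2 (m l : ℝ))) ∧
    (∃ n : ℕ → ℕ, StrictMono n ∧ n 0 = 0 ∧ (∀ l, n (l + 1) = 4 * n l + 16) ∧
      Asymptotics.IsEquivalent atTop
        (fun l : ℕ => (exceptionalCount 3 (n l : ℝ) : ℝ) - (n l : ℝ) / 12)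
        (fun l : ℕ => -(1 / 6 : ℝ) * Real.logb 2 (n l : ℝ))) := by
  refine ⟨fun x hx => exceptionalCount_three_lower hx,
    fun x hx hx2 => exceptionalCount_three_upper hx hx2, tendsto_exceptionalCount_three_div,
    ⟨affineSeq 8, strictMono_affineSeq (by norm_num), rfl, fun l => rfl, ?_⟩,
    ⟨affineSeq 16, strictMono_affineSeq (by norm_num), rfl, fun l => rfl, ?_⟩⟩
  · refine isEquivalent_affineSeq (by norm_num) (by norm_num) (by norm_num) _
      (abs_of_pos (by norm_num)) fun l => ?_
    have h : 3 * (repeatCount (affineSeq 8 l / 4) : ℝ) = (affineSeq 8 l / 4 : ℕ) + l := by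
      exact_mod_cast three_mul_repeatCount_affineSeq_eight l
    linarith
  · refine isEquivalent_affineSeq (by norm_num) (by norm_num) (by norm_num) _
      (by rw [abs_neg]; exact abs_of_pos (by norm_num)) fun l => ?_
    have h : 3 * (repeatCount (affineSeq 16 l / 4) : ℝ) + l = (affineSeq 16 l / 4 : ℕ) := by
      exact_mod_cast three_mul_repeatCount_affineSeq_sixteen l
    linarith
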